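/- Let $\eta\ge 0$ be an integer and let $K:\mathbb{R}\to\mathbb{R}$ be $2\pi$-periodic and $\eta$ times continuously differentiable on $\mathbb{R}$ (merely continuous if $\eta=0$); in particular $K\in W^{\eta,\infty}([-\pi,\pi])$. Suppose that there is a finite division $-\pi=\mathcal T_0<\mathcal T_1<\dots<\mathcal T_P=\pi$ such that, for every $i$, the restriction of $K$ to $(\mathcal T_i,\mathcal T_{i+1})$ agrees with a function that belongs to $C^\infty([\mathcal T_i,\mathcal T_{i+1}])$. Put $$M_{\eta+1}=\sup\{|K^{(\eta+1)}(r)| : r\in[-\pi,\pi]\setminus\{\mathcal T_0,\dots,\mathcal T_P\}\}.$$ For $n\ge 1$ let $V_n[K]=\frac1n\sum_{\ell=n}^{2n-1}S_\ell[K]$ be the de la Vallée-Poussin sum of $K$, where $$S_\ell[K](r)=\frac1{2\pi}\int_{-\pi}^{\pi}K(\tau)\,d\tau+\frac1\pi\sum_{j=1}^{\ell}\Big(\cos(jr)\int_{-\pi}^{\pi}K(\tau)\cos(j\tau)\,d\tau+\sin(jr)\int_{-\pi}^{\pi}K(\tau)\sin(j\tau)\,d\tau\Big)$$ is the $\ell$-th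 partial sum of the Fourier series of $K$. Then $M_{\eta+1}<\infty$, and for all $n\ge1$ and all $r\in\mathbb{R}$, $$|V_n[K](r)-K(r)|\le\begin{cases}\dfrac{16(\eta+2)^2M_{\eta+1}}{\pi n(n+1)^{\eta}}, & \eta\ge1,\\[2ex] \dfrac{M_1}{n\pi}\,(58+32\ln2), & \eta=0.\end{cases}$$ If moreover $K$ is even, the same bound holds with $V_n[K]$ replaced by the cosine sum $$\frac{2}{n\pi}\sum_{\ell=n}^{2n-1}\sum_{j=0}^{\ell}\alpha_j\cos(jr)\int_0^{\pi}K(\tau)\cos(j\tau)\,d\tau,\qquad \alpha_0=\tfrac12,\quad \alpha_j=1\ (j\ge1).$$ -/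

import Mathlib

open scoped ContDiff

noncomputable section

/-- The `ℓ`-th partial sum `S_ℓ[K](r)` of the Fourier series of a `2π`-periodic function `K`. -/
def fourierPartialSum (ℓ : ℕ) (K : ℝ → ℝ) (r : ℝ) : ℝ :=
  (1 / (2 * Real.pi)) * (∫ τ in (-Real.pi)..Real.pi, K τ) +
    (1 / Real.pi) * ∑ j ∈ Finset.Icc 1 ℓ,
      (Real.cos (j * r) * (∫ τ in (-Real.pi)..Real.pi, K τ * Real.cos (j * τ)) +
        Real.sin (j * r) * (∫ τ in (-Real.pi)..Real.pi, K τ * Real.sin (j * τ)))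

/-- The de la Vallée-Poussin sum of a `2π`-periodic function: the mean of the Fourier partial
sums `S_n, …, S_{2n-1}`. -/
def vpFourierSum (n : ℕ) (K : ℝ → ℝ) (r : ℝ) : ℝ :=
  (1 / (n : ℝ)) * ∑ ℓ ∈ Finset.Icc n (2 * n - 1), fourierPartialSum ℓ K r

/-- The weights `α_0 = 1/2` and `α_j = 1` for `j ≥ 1`. -/
def vpWeight (j : ℕ) : ℝ := if j = 0 then 1 / 2 else 1

/-- The de la Vallée-Poussin sum of an even `2π`-periodic function, as a cosine sum
`V_n[K](r) = 2/(nπ) ∑_{ℓ=n}^{2n-1} ∑_{j=0}^{ℓ} α_j cos(jr) ∫_0^π K(τ) cos(jτ) dτ`. -/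
def vpSum (n : ℕ) (K : ℝ → ℝ) (r : ℝ) : ℝ :=
  (2 / (n * Real.pi)) * ∑ ℓ ∈ Finset.Icc n (2 * n - 1), ∑ j ∈ Finset.range (ℓ + 1),
    vpWeight j * Real.cos (j * r) * ∫ τ in (0 : ℝ)..Real.pi, K τ * Real.cos (j * τ)

/-- `T` is a finite division `-π = T 0 < T 1 < ⋯ < T P = π` of `[-π, π]`. -/
structure IsDivision {P : ℕ} (T : Fin (P + 1) → ℝ) : Prop where
  strictMono : StrictMono T
  left : T 0 = -Real.pi
  right : T (Fin.last P) = Real.pi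

/-- On each closed interval `[T i, T (i+1)]` the function `K` becomes `C^∞` (up to and including
the end points) after redefining it at the end points. -/
def IsPiecewiseSmooth {P : ℕ} (T : Fin (P + 1) → ℝ) (K : ℝ → ℝ) : Prop :=
  ∀ i : Fin P, ∃ g : ℝ → ℝ, ContDiffOn ℝ ∞ g (Set.Icc (T i.castSucc) (T i.succ)) ∧
    Set.EqOn K g (Set.Ioo (T i.castSucc) (T i.succ))

/-- The values `|K^{(m)}(r)|` for `r` in `[-π, π]` away from the division points. -/
def absDerivValues {P : ℕ} (T : Fin (P + 1) → ℝ) (K : ℝ → ℝ) (m : ℕ) : Set ℝ :=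
  (fun r => |iteratedDeriv m K r|) '' (Set.Icc (-Real.pi) Real.pi \ Set.range T)

/-- `M_m = max_r |K^{(m)}(r)|`, the maximum of the piecewise `m`-th derivative. -/
def maxAbsDeriv {P : ℕ} (T : Fin (P + 1) → ℝ) (K : ℝ → ℝ) (m : ℕ) : ℝ :=
  sSup (absDerivValues T K m)

/-- The right-hand side of the error estimate, with `M` in the place of `M_{η+1}`. -/
def vpErrorBound (η n : ℕ) (M : ℝ) : ℝ :=
  if η = 0 then M / (n * Real.pi) * (58 + 32 * Real.log 2)
  else 16 * ((η : ℝ) + 2) ^ 2 * M / (Real.pi * n * ((n : ℝ) + 1) ^ η)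

end

/-! Write `Δ²a j` for `a j - 2 * a (j + 1) + a (j + 2)`. The sum `V_n` is a difference of two
Fejér-type means: it has norm at most 3 on bounded functions and fixes trigonometric polynomials of
degree at most `n`, so its error is at most four times the distance from `K` to `trigSpace n`
(`abs_vpFourierSum_sub_self_le`). It remains to prove a Jackson theorem with explicit constants.

Every kernel used is built from `|∑ b_k e^{iky}|²`. Such a kernel is nonnegative, so its operator
norm is its mean, and it acts on harmonics by the autocorrelation of `b` (`squareMean_trigPoly`).
The Fejér–Korovkin choice of `b` approximates Lipschitz functions (`abs_squareMean_sub_self_le`).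
For higher smoothness, a derivative of order `2p` is inverted on frequencies above `n` by a
multiplier equal to `l ^ (-2p)` there and extended below as a convex sequence; a convex multiplier
is a nonnegative combination of Fejér kernels, of norm at most its value at 0
(`exists_approx_of_approx_pow_mul`). For even `η` this is applied to a Fejér–Korovkin approximation
of the `η`-th derivative, for odd `η` to the bounded derivative of order `η + 1`.

This works on trigonometric polynomials. A general `K` is first replaced by its Fejér–Korovkin mean
of degree `L`, which keeps the Lipschitz constant of the `η`-th derivative, and then `L → ∞`. That
constant is `M_{η+1}`, because the `η`-th derivative is continuous and differentiable off a
countable set. -/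

/-! ### Nonnegative kernels and their action on harmonics -/

open Real in
/-- The kernel `|∑_{k<N} b_k e^{iky}|²`. -/
noncomputable def squareKernel (N : ℕ) (b : ℕ → ℝ) (y : ℝ) : ℝ :=
  (∑ k ∈ Finset.range N, b k * cos (k * y)) ^ 2 + (∑ k ∈ Finset.range N, b k * sin (k * y)) ^ 2

theorem squareKernel_nonneg (N : ℕ) (b : ℕ → ℝ) (y : ℝ) : 0 ≤ squareKernel N b y := by
  unfold squareKernel; positivity

theorem continuous_squareKernel (N : ℕ) (b : ℕ → ℝ) : Continuous (squareKernel N b) := by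
  unfold squareKernel; fun_prop

theorem squareKernel_eq_sum (N : ℕ) (b : ℕ → ℝ) (y : ℝ) :
    squareKernel N b y = ∑ k ∈ Finset.range N, ∑ k' ∈ Finset.range N,
      b k * b k' * Real.cos (((k - k' : ℤ) : ℝ) * y) := by
  unfold squareKernel
  rw [sq, sq, Finset.sum_mul_sum, Finset.sum_mul_sum, ← Finset.sum_add_distrib]
  refine Finset.sum_congr rfl fun k _ => ?_
  rw [← Finset.sum_add_distrib]
  refine Finset.sum_congr rfl fun k' _ => ?_
  push_cast
  rw [sub_mul, Real.cos_sub]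
  ring

/-- Convolution of `f` with `cos (j ·) / (2π)` over a period. -/
noncomputable def freqPart (j : ℤ) (f : ℝ → ℝ) (x : ℝ) : ℝ :=
  (1 / (2 * Real.pi)) * ∫ t in (-Real.pi)..Real.pi, f t * Real.cos (j * (x - t))

/-- Convolution of `f` with `squareKernel N b / (2π)` over a period. -/
noncomputable def squareMean (N : ℕ) (b : ℕ → ℝ) (f : ℝ → ℝ) (x : ℝ) : ℝ :=
  (1 / (2 * Real.pi)) * ∫ t in (-Real.pi)..Real.pi, f t * squareKernel N b (x - t)

theorem freqPart_neg (j : ℤ) (f : ℝ → ℝ) (x : ℝ) : freqPart (-j) f x = freqPart j f x := by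
  unfold freqPart
  congr 2; ext t
  push_cast
  rw [neg_mul, Real.cos_neg]

theorem squareMean_eq_sum (N : ℕ) (b : ℕ → ℝ) {f : ℝ → ℝ} (hf : Continuous f) (x : ℝ) :
    squareMean N b f x = ∑ k ∈ Finset.range N, ∑ k' ∈ Finset.range N,
      b k * b k' * freqPart (k - k') f x := by
  unfold squareMean freqPart
  simp_rw [squareKernel_eq_sum, Finset.mul_sum]
  rw [intervalIntegral.integral_finsetSum
    fun k _ => (by fun_prop : Continuous _).intervalIntegrable _ _]
  rw [Finset.mul_sum]
  refine Finset.sum_congr rfl fun k _ => ?_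
  rw [intervalIntegral.integral_finsetSum
    fun k _ => (by fun_prop : Continuous _).intervalIntegrable _ _]
  rw [Finset.mul_sum]
  refine Finset.sum_congr rfl fun k' _ => ?_
  rw [mul_left_comm]
  congr 1
  rw [← intervalIntegral.integral_const_mul]
  congr 1; ext t; ring

theorem integral_cos_add_int_mul (a : ℝ) (m : ℤ) :
    ∫ t in (-Real.pi)..Real.pi, Real.cos (a + m * t) =
      if m = 0 then 2 * Real.pi * Real.cos a else 0 := by
  split_ifs with h
  · subst h; simp only [Int.cast_zero, zero_mul, add_zero,
      intervalIntegral.integral_const, smul_eq_mul]; ring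
  · have hm : (m : ℝ) ≠ 0 := by exact_mod_cast h
    rw [intervalIntegral.integral_comp_add_mul (fun y => Real.cos y) hm, integral_cos]
    have : a + m * Real.pi = (a + m * -Real.pi) + m * (2 * Real.pi) := by ring
    rw [this, Real.sin_add_int_mul_two_pi]
    simp

theorem integral_sin_add_int_mul (a : ℝ) (m : ℤ) :
    ∫ t in (-Real.pi)..Real.pi, Real.sin (a + m * t) =
      if m = 0 then 2 * Real.pi * Real.sin a else 0 := by
  have h := integral_cos_add_int_mul (a - Real.pi / 2) m
  rw [Real.cos_sub_pi_div_two] at h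
  rw [← h]
  congr 1; ext t
  rw [← Real.cos_sub_pi_div_two]; ring_nf

/-- Product-to-sum formulas leave the frequencies `l - j` and `-j - l` in `t`, and only frequency
zero survives integration. For `j = l = 0` both indicators fire, which compensates the factor `1 /
2`. -/
theorem freqPart_harmonic (j : ℤ) (l : ℕ) (α β x : ℝ) :
    freqPart j (fun t => α * Real.cos (l * t) + β * Real.sin (l * t)) x =
      (1 / 2) * ((if j = l then 1 else 0) + if -j = l then 1 else 0) *
        (α * Real.cos (l * x) + β * Real.sin (l * x)) := by
  have hint : ∀ t : ℝ, (α * Real.cos (l * t) + β * Real.sin (l * t)) * Real.cos (j * (x - t)) =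
      (α / 2 * Real.cos (j * x + (l - j : ℤ) * t) + β / 2 * Real.sin (j * x + (l - j : ℤ) * t)) +
      (α / 2 * Real.cos (j * x + (-j - l : ℤ) * t)
        + - (β / 2) * Real.sin (j * x + (-j - l : ℤ) * t)) := by
    intro t
    have e1 : (j : ℝ) * x + (l - j : ℤ) * t = j * (x - t) + l * t := by push_cast; ring
    have e2 : (j : ℝ) * x + (-j - l : ℤ) * t = j * (x - t) - l * t := by push_cast; ring
    rw [e1, e2, Real.cos_add, Real.sin_add, Real.cos_sub, Real.sin_sub]
    ring
  unfold freqPart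
  simp_rw [hint]
  rw [intervalIntegral.integral_add, intervalIntegral.integral_add, intervalIntegral.integral_add]
  · simp_rw [intervalIntegral.integral_const_mul, integral_cos_add_int_mul,
      integral_sin_add_int_mul]
    have hπ := Real.pi_ne_zero
    have c1 : ((l : ℤ) - j = 0) ↔ j = l := by omega
    have c2 : (-j - (l : ℤ) = 0) ↔ -j = l := by omega
    simp only [c1, c2]
    by_cases h1 : j = l
    · subst h1
      by_cases h2 : -(l : ℤ) = l
      · have : l = 0 := by omega
        subst this
        simp; field_simp
      · simp [h2]; field_simp
    · by_cases h2 : -j = l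
      · have : (l : ℝ) = -j := by exact_mod_cast h2.symm
        simp [h1, h2, this]; field_simp
      · simp [h1, h2]
  all_goals exact (by fun_prop : Continuous _).intervalIntegrable _ _

/-- Trigonometric polynomials of degree at most `L`. -/
noncomputable def trigPoly (L : ℕ) (α β : ℕ → ℝ) (x : ℝ) : ℝ :=
  ∑ l ∈ Finset.range (L + 1), (α l * Real.cos (l * x) + β l * Real.sin (l * x))

theorem continuous_trigPoly (L : ℕ) (α β : ℕ → ℝ) : Continuous (trigPoly L α β) := by
  unfold trigPoly; fun_prop

theorem freqPart_trigPoly (j : ℤ) (L : ℕ) (α β : ℕ → ℝ) (x : ℝ) :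
    freqPart j (trigPoly L α β) x = ∑ l ∈ Finset.range (L + 1),
      (1 / 2) * ((if j = l then 1 else 0) + if -j = l then 1 else 0) *
        (α l * Real.cos (l * x) + β l * Real.sin (l * x)) := by
  simp_rw [← freqPart_harmonic]
  unfold freqPart trigPoly
  simp_rw [Finset.sum_mul]
  rw [intervalIntegral.integral_finsetSum
    fun k _ => (by fun_prop : Continuous _).intervalIntegrable _ _, Finset.mul_sum]

/-- The factor by which `squareMean N b` multiplies harmonics of frequency `l`. -/
noncomputable def autocorr (N : ℕ) (b : ℕ → ℝ) (l : ℕ) : ℝ :=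
  ∑ k ∈ Finset.range (N - l), b k * b (k + l)

theorem sum_sum_ite_sub_eq (N : ℕ) (b : ℕ → ℝ) (l : ℕ) :
    ∑ k ∈ Finset.range N, ∑ k' ∈ Finset.range N,
      b k * b k' * (if (k' : ℤ) - k = l then 1 else 0) = autocorr N b l := by
  unfold autocorr
  have h : ∀ k ∈ Finset.range N, ∑ k' ∈ Finset.range N,
      b k * b k' * (if (k' : ℤ) - k = l then 1 else 0) =
      if k < N - l then b k * b (k + l) else 0 := by
    intro k _
    have : ∀ k' : ℕ, ((k' : ℤ) - k = l) ↔ k' = k + l := by intro k'; omega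
    simp only [this, mul_ite, mul_one, mul_zero, Finset.sum_ite_eq', Finset.mem_range]
    have : k + l < N ↔ k < N - l := by omega
    simp only [this]
  rw [Finset.sum_congr rfl h, ← Finset.sum_filter]
  congr 1
  ext k; simp only [Finset.mem_filter, Finset.mem_range]; omega

/-- In the double sum only the diagonals `k - k' = l` and `k - k' = -l` see frequency `l`; each
contributes half of `autocorr N b l`. -/
theorem squareMean_trigPoly (N : ℕ) (b : ℕ → ℝ) (L : ℕ) (α β : ℕ → ℝ) :
    squareMean N b (trigPoly L α β) =
      trigPoly L (fun l => autocorr N b l * α l) (fun l => autocorr N b l * β l) := by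
  ext x
  rw [squareMean_eq_sum _ _ (continuous_trigPoly _ _ _)]
  simp_rw [freqPart_trigPoly, Finset.mul_sum]
  rw [Finset.sum_congr rfl fun k _ => Finset.sum_comm, Finset.sum_comm]
  unfold trigPoly
  refine Finset.sum_congr rfl fun l _ => ?_
  have h1 := sum_sum_ite_sub_eq N b l
  have h2 : ∑ k ∈ Finset.range N, ∑ k' ∈ Finset.range N,
      b k * b k' * (if (k : ℤ) - k' = l then 1 else 0) = autocorr N b l := by
    rw [Finset.sum_comm, ← h1]
    exact Finset.sum_congr rfl fun k _ => Finset.sum_congr rfl fun k' _ => by ring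
  have h3 : ∀ k k' : ℕ, b k * b k' * ((1 / 2) * ((if (k : ℤ) - k' = l then 1 else 0) +
      if -((k : ℤ) - k') = l then 1 else 0) *
        (α l * Real.cos (l * x) + β l * Real.sin (l * x))) =
      ((α l * Real.cos (l * x) + β l * Real.sin (l * x)) / 2) *
        (b k * b k' * (if (k : ℤ) - k' = l then 1 else 0) +
        b k * b k' * (if (k' : ℤ) - k = l then 1 else 0)) := by
    intro k k'; rw [neg_sub]; ring
  simp_rw [h3, ← Finset.mul_sum, Finset.sum_add_distrib, h1, h2]
  ring

theorem integral_squareKernel_sub (N : ℕ) (b : ℕ → ℝ) (x : ℝ) :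
    (1 / (2 * Real.pi)) * ∫ t in (-Real.pi)..Real.pi, squareKernel N b (x - t) =
      autocorr N b 0 := by
  have h := congrFun (squareMean_trigPoly N b 0 1 0) x
  have h1 : trigPoly 0 1 0 = fun _ => 1 := by ext; simp [trigPoly]
  rw [h1] at h
  simpa [squareMean, trigPoly] using h

theorem autocorr_zero (N : ℕ) (b : ℕ → ℝ) :
    autocorr N b 0 = ∑ k ∈ Finset.range N, b k ^ 2 := by
  simp [autocorr, sq]

/-- Since the kernel is nonnegative, its `L¹` mean equals its plain mean `autocorr N b 0`. -/
theorem abs_squareMean_le (N : ℕ) (b : ℕ → ℝ) {f : ℝ → ℝ} {B : ℝ}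
    (hB : ∀ x, |f x| ≤ B) (x : ℝ) : |squareMean N b f x| ≤ autocorr N b 0 * B := by
  rw [← integral_squareKernel_sub N b x, mul_assoc, squareMean, abs_mul,
    abs_of_pos (by positivity), ← intervalIntegral.integral_mul_const]
  have hW := continuous_squareKernel N b
  refine mul_le_mul_of_nonneg_left ?_ (by positivity)
  refine intervalIntegral.norm_integral_le_of_norm_le (f := fun t => f t * squareKernel N b (x - t))
    (by linarith [Real.pi_pos])
    (Filter.Eventually.of_forall fun t _ => ?_)
    ((by fun_prop : Continuous _).intervalIntegrable _ _)
  rw [Real.norm_eq_abs, abs_mul, abs_of_nonneg (squareKernel_nonneg _ _ _), mul_comm]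
  exact mul_le_mul_of_nonneg_left (hB t) (squareKernel_nonneg _ _ _)

theorem squareMean_sub (N : ℕ) (b : ℕ → ℝ) {f g : ℝ → ℝ} (hf : Continuous f) (hg : Continuous g)
    (x : ℝ) : squareMean N b (fun t => f t - g t) x = squareMean N b f x - squareMean N b g x := by
  have hW := continuous_squareKernel N b
  unfold squareMean
  rw [← mul_sub, ← intervalIntegral.integral_sub]
  · simp_rw [sub_mul]
  all_goals exact (by fun_prop : Continuous _).intervalIntegrable _ _

/-! ### The space of trigonometric polynomials -/

/-- The space of trigonometric polynomials of degree at most `n`. -/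
noncomputable def trigSpace (n : ℕ) : Submodule ℝ (ℝ → ℝ) where
  carrier := {f | ∃ α β, f = trigPoly n α β}
  add_mem' := by
    rintro _ _ ⟨α, β, rfl⟩ ⟨α', β', rfl⟩
    refine ⟨α + α', β + β', ?_⟩
    ext x
    simp only [trigPoly, Pi.add_apply, ← Finset.sum_add_distrib]
    exact Finset.sum_congr rfl fun l _ => by ring
  zero_mem' := ⟨0, 0, by ext; simp [trigPoly]⟩
  smul_mem' := by
    rintro c _ ⟨α, β, rfl⟩
    refine ⟨c • α, c • β, ?_⟩
    ext x
    simp only [trigPoly, Pi.smul_apply, smul_eq_mul, Finset.mul_sum]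
    exact Finset.sum_congr rfl fun l _ => by ring

theorem trigPoly_mem_trigSpace (n : ℕ) (α β : ℕ → ℝ) : trigPoly n α β ∈ trigSpace n :=
  ⟨α, β, rfl⟩

theorem continuous_of_mem_trigSpace {n : ℕ} {f : ℝ → ℝ} (hf : f ∈ trigSpace n) :
    Continuous f := by
  obtain ⟨α, β, rfl⟩ := hf
  exact continuous_trigPoly _ _ _

theorem cos_natCast_mul_mem_trigSpace {n l : ℕ} (hl : l ≤ n) :
    (fun x : ℝ => Real.cos (l * x)) ∈ trigSpace n := by
  refine ⟨Pi.single l 1, 0, ?_⟩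
  ext x
  simp [trigPoly, Pi.single_apply]
  omega

theorem sin_natCast_mul_mem_trigSpace {n l : ℕ} (hl : l ≤ n) :
    (fun x : ℝ => Real.sin (l * x)) ∈ trigSpace n := by
  refine ⟨0, Pi.single l 1, ?_⟩
  ext x
  simp [trigPoly, Pi.single_apply]
  omega

theorem freqPart_eq {f : ℝ → ℝ} (hf : Continuous f) (j : ℤ) (x : ℝ) :
    freqPart j f x = (1 / (2 * Real.pi)) *
      (Real.cos (j * x) * (∫ t in (-Real.pi)..Real.pi, f t * Real.cos (j * t)) +
        Real.sin (j * x) * ∫ t in (-Real.pi)..Real.pi, f t * Real.sin (j * t)) := by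
  unfold freqPart
  rw [← intervalIntegral.integral_const_mul (Real.cos (j * x)),
    ← intervalIntegral.integral_const_mul (Real.sin (j * x)), ← intervalIntegral.integral_add]
  · congr 2; ext t
    rw [mul_sub, Real.cos_sub]; ring
  all_goals exact (by fun_prop : Continuous _).intervalIntegrable _ _

theorem freqPart_mem_trigSpace {f : ℝ → ℝ} (hf : Continuous f) {j : ℤ} {n : ℕ}
    (hj : j.natAbs ≤ n) : freqPart j f ∈ trigSpace n := by
  wlog h : 0 ≤ j generalizing j
  · have := this (j := -j) (by omega) (by omega)
    rwa [funext (freqPart_neg j f)] at this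
  lift j to ℕ using h
  have : freqPart j f =
      ((1 / (2 * Real.pi)) * ∫ t in (-Real.pi)..Real.pi, f t * Real.cos (j * t)) •
        (fun x : ℝ => Real.cos (j * x)) +
      ((1 / (2 * Real.pi)) * ∫ t in (-Real.pi)..Real.pi, f t * Real.sin (j * t)) •
        (fun x : ℝ => Real.sin (j * x)) := by
    ext x
    simp only [freqPart_eq hf, Pi.add_apply, Pi.smul_apply, smul_eq_mul, Int.cast_natCast]
    ring
  rw [this]
  simp only [Int.natAbs_natCast] at hj
  exact add_mem (Submodule.smul_mem _ _ (cos_natCast_mul_mem_trigSpace hj))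
    (Submodule.smul_mem _ _ (sin_natCast_mul_mem_trigSpace hj))

theorem squareMean_eq_sum_fun (N : ℕ) (b : ℕ → ℝ) {f : ℝ → ℝ} (hf : Continuous f) :
    squareMean N b f = ∑ k ∈ Finset.range N, ∑ k' ∈ Finset.range N,
      (b k * b k') • freqPart (k - k') f := by
  ext x
  simp [squareMean_eq_sum N b hf x, Finset.sum_apply]

theorem squareMean_mem_trigSpace {N n : ℕ} (hN : N ≤ n + 1) (b : ℕ → ℝ) {f : ℝ → ℝ}
    (hf : Continuous f) : squareMean N b f ∈ trigSpace n := by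
  rw [squareMean_eq_sum_fun N b hf]
  refine sum_mem fun k hk => sum_mem fun k' hk' =>
    Submodule.smul_mem _ _ (freqPart_mem_trigSpace hf ?_)
  simp only [Finset.mem_range] at hk hk'
  omega

/-! ### De la Vallée-Poussin sums as near-best approximations -/

theorem fourierPartialSum_eq_freqPart {f : ℝ → ℝ} (hf : Continuous f) (ℓ : ℕ) (x : ℝ) :
    fourierPartialSum ℓ f x = freqPart 0 f x + 2 * ∑ j ∈ Finset.Icc 1 ℓ, freqPart j f x := by
  simp_rw [freqPart_eq hf, ← Finset.mul_sum]
  unfold fourierPartialSum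
  simp only [Int.cast_zero, zero_mul, Real.cos_zero, Real.sin_zero, one_mul, mul_one, mul_zero,
    add_zero, Int.cast_natCast]
  rw [← mul_assoc 2]
  congr 2
  field_simp

/-- Passing from `N` to `N + 1` adds a row and a column to the square of pairs `(k, k')`. Their
differences run once through `-N, …, N`, which is the `N`-th Fourier partial sum. -/
theorem squareMean_one_eq_sum {f : ℝ → ℝ} (hf : Continuous f) (N : ℕ) (x : ℝ) :
    squareMean N 1 f x = ∑ ℓ ∈ Finset.range N, fourierPartialSum ℓ f x := by
  rw [squareMean_eq_sum N 1 hf]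
  simp only [Pi.one_apply, mul_one, one_mul]
  induction N with
  | zero => simp
  | succ N ih =>
    rw [Finset.sum_range_succ (fun ℓ => fourierPartialSum ℓ f x), ← ih]
    simp_rw [Finset.sum_range_succ _ N]
    rw [Finset.sum_add_distrib, fourierPartialSum_eq_freqPart hf]
    have h1 : ∑ k ∈ Finset.range N, freqPart ((N : ℤ) - k) f x =
        ∑ j ∈ Finset.Icc 1 N, freqPart j f x := by
      refine Finset.sum_bij' (fun k _ => N - k) (fun k _ => N - k) ?_ ?_ ?_ ?_ ?_
      · intro k hk; simp only [Finset.mem_range, Finset.mem_Icc] at *; omega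
      · intro k hk; simp only [Finset.mem_range, Finset.mem_Icc] at *; omega
      · intro k hk; simp only [Finset.mem_range] at *; omega
      · intro k hk; simp only [Finset.mem_Icc] at *; omega
      · intro k hk
        rw [Finset.mem_range] at hk
        rw [Nat.cast_sub hk.le]
    have h2 : ∑ k ∈ Finset.range N, freqPart ((k : ℤ) - N) f x =
        ∑ j ∈ Finset.Icc 1 N, freqPart j f x := by
      rw [← h1]
      refine Finset.sum_congr rfl fun k _ => ?_
      rw [← freqPart_neg, neg_sub]
    rw [h1, h2, sub_self]
    ring

theorem vpFourierSum_eq {f : ℝ → ℝ} (hf : Continuous f) {n : ℕ} (hn : 1 ≤ n) (x : ℝ) :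
    vpFourierSum n f x = (1 / (n : ℝ)) * (squareMean (2 * n) 1 f x - squareMean n 1 f x) := by
  have : Finset.Icc n (2 * n - 1) = Finset.Ico n (2 * n) := by
    ext; simp only [Finset.mem_Icc, Finset.mem_Ico]; omega
  rw [vpFourierSum, this, Finset.sum_Ico_eq_sub _ (by omega), squareMean_one_eq_sum hf,
    squareMean_one_eq_sum hf]

theorem autocorr_one (N l : ℕ) : autocorr N 1 l = ((N - l : ℕ) : ℝ) := by
  simp [autocorr]

/-- For `l ≤ n` the multiplier is `((2n - l) - (n - l)) / n = 1`. -/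
theorem vpFourierSum_of_mem_trigSpace {n : ℕ} (hn : 1 ≤ n) {q : ℝ → ℝ} (hq : q ∈ trigSpace n)
    (x : ℝ) : vpFourierSum n q x = q x := by
  obtain ⟨α, β, rfl⟩ := hq
  rw [vpFourierSum_eq (continuous_trigPoly _ _ _) hn, squareMean_trigPoly, squareMean_trigPoly]
  unfold trigPoly
  rw [← Finset.sum_sub_distrib, Finset.mul_sum]
  refine Finset.sum_congr rfl fun l hl => ?_
  rw [Finset.mem_range] at hl
  simp only [autocorr_one]
  rw [Nat.cast_sub (by omega), Nat.cast_sub (by omega)]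
  have : (n : ℝ) ≠ 0 := by positivity
  push_cast
  field_simp
  ring

/-- The two Fejér-type means have norms `2n` and `n`, whence `(2n + n) / n = 3`. -/
theorem abs_vpFourierSum_le {f : ℝ → ℝ} (hf : Continuous f) {n : ℕ} (hn : 1 ≤ n) {B : ℝ}
    (hB : ∀ x, |f x| ≤ B) (x : ℝ) : |vpFourierSum n f x| ≤ 3 * B := by
  have hn' : (0 : ℝ) < n := by positivity
  have h1 := abs_squareMean_le (2 * n) 1 hB x
  have h2 := abs_squareMean_le n 1 hB x
  simp only [autocorr_one, Nat.sub_zero, Nat.cast_mul, Nat.cast_ofNat] at h1 h2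
  rw [vpFourierSum_eq hf hn, abs_mul, abs_of_pos (by positivity), one_div,
    inv_mul_le_iff₀ hn']
  exact (abs_sub _ _).trans (by linarith)

theorem vpFourierSum_sub {f g : ℝ → ℝ} (hf : Continuous f) (hg : Continuous g) {n : ℕ}
    (hn : 1 ≤ n) (x : ℝ) :
    vpFourierSum n (fun t => f t - g t) x = vpFourierSum n f x - vpFourierSum n g x := by
  rw [vpFourierSum_eq (by fun_prop) hn, vpFourierSum_eq hf hn, vpFourierSum_eq hg hn,
    squareMean_sub _ _ hf hg, squareMean_sub _ _ hf hg]
  ring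

theorem abs_vpFourierSum_sub_self_le {f q : ℝ → ℝ} (hf : Continuous f) {n : ℕ} (hn : 1 ≤ n)
    (hq : q ∈ trigSpace n) {B : ℝ} (hB : ∀ x, |f x - q x| ≤ B) (x : ℝ) :
    |vpFourierSum n f x - f x| ≤ 4 * B := by
  have hqc := continuous_of_mem_trigSpace hq
  have h := abs_vpFourierSum_le (f := fun t => f t - q t) (by fun_prop) hn hB x
  rw [vpFourierSum_sub hf hqc hn, vpFourierSum_of_mem_trigSpace hn hq] at h
  have h2 := hB x
  rw [abs_le] at *
  constructor <;> linarith [h.1, h.2, h2.1, h2.2]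

/-! ### The Fejér–Korovkin kernel and Jackson's estimate -/

theorem autocorr_const_mul (N : ℕ) (c : ℝ) (b : ℕ → ℝ) (l : ℕ) :
    autocorr N (fun k => c * b k) l = c ^ 2 * autocorr N b l := by
  unfold autocorr
  rw [Finset.mul_sum]
  exact Finset.sum_congr rfl fun k _ => by ring

/-- The vector `sin ((k + 1) θ)` vanishes at both neighbours `k = -1` and `k = L + 1` of its range,
so it is an eigenvector of the adjacency matrix of a path, with eigenvalue `2 cos θ`. -/
theorem autocorr_sin_one (L : ℕ) :
    autocorr (L + 1) (fun k => Real.sin ((k + 1) * (Real.pi / (L + 2)))) 1 =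
      Real.cos (Real.pi / (L + 2)) *
        autocorr (L + 1) (fun k => Real.sin ((k + 1) * (Real.pi / (L + 2)))) 0 := by
  set θ := Real.pi / (L + 2) with hθ
  have hend : Real.sin ((L + 2 : ℝ) * θ) = 0 := by
    rw [hθ, mul_div_cancel₀ _ (by positivity), Real.sin_pi]
  have h1 : ∑ k ∈ Finset.range (L + 1), Real.sin ((k + 1 : ℝ) * θ) * Real.sin ((k + 2 : ℝ) * θ) =
      ∑ k ∈ Finset.range L, Real.sin ((k + 1 : ℝ) * θ) * Real.sin ((k + 2 : ℝ) * θ) := by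
    rw [Finset.sum_range_succ, hend, mul_zero, add_zero]
  have h2 : ∑ k ∈ Finset.range (L + 1), Real.sin ((k + 1 : ℝ) * θ) * Real.sin ((k : ℝ) * θ) =
      ∑ k ∈ Finset.range L, Real.sin ((k + 1 : ℝ) * θ) * Real.sin ((k + 2 : ℝ) * θ) := by
    rw [Finset.sum_range_succ']
    simp only [Nat.cast_zero, zero_mul, Real.sin_zero, mul_zero, add_zero]
    refine Finset.sum_congr rfl fun k _ => ?_
    push_cast
    rw [mul_comm]; ring_nf
  have h3 : ∀ k : ℕ, Real.sin ((k + 1 : ℝ) * θ) * Real.sin ((k + 1 : ℝ) * θ) * (2 * Real.cos θ) =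
      Real.sin ((k + 1 : ℝ) * θ) * Real.sin ((k + 2 : ℝ) * θ) +
      Real.sin ((k + 1 : ℝ) * θ) * Real.sin ((k : ℝ) * θ) := by
    intro k
    have e1 : (k + 2 : ℝ) * θ = (k + 1) * θ + θ := by ring
    have e2 : (k : ℝ) * θ = (k + 1) * θ - θ := by ring
    rw [e1, e2, Real.sin_add, Real.sin_sub]; ring
  have h4 := Finset.sum_congr (rfl : Finset.range (L + 1) = Finset.range (L + 1))
    fun k _ => h3 k
  rw [Finset.sum_add_distrib, h1, h2, ← Finset.sum_mul] at h4
  simp only [autocorr, Nat.add_sub_cancel, Nat.sub_zero, add_zero, Nat.cast_add, Nat.cast_one]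
  have e : ∀ k : ℕ, (k + 1 + 1 : ℝ) = k + 2 := fun k => by ring
  simp_rw [e]
  linarith

/-- The coefficients of the Fejér–Korovkin kernel. -/
theorem exists_korovkin_coeff (L : ℕ) : ∃ b : ℕ → ℝ, autocorr (L + 1) b 0 = 1 ∧
    autocorr (L + 1) b 1 = Real.cos (Real.pi / (L + 2)) := by
  set s : ℕ → ℝ := fun k => Real.sin ((k + 1) * (Real.pi / (L + 2))) with hs
  have hpos : 0 < autocorr (L + 1) s 0 := by
    rw [autocorr_zero]
    refine Finset.sum_pos' (fun _ _ => sq_nonneg _) ⟨0, by simp, ?_⟩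
    have : 0 < s 0 := by
      refine Real.sin_pos_of_pos_of_lt_pi (by positivity) ?_
      simp only [Nat.cast_zero, zero_add, one_mul]
      exact div_lt_self Real.pi_pos (by linarith [(Nat.cast_nonneg L : (0:ℝ) ≤ L)])
    positivity
  refine ⟨fun k => (√(autocorr (L + 1) s 0))⁻¹ * s k, ?_, ?_⟩
  · rw [autocorr_const_mul, inv_pow, Real.sq_sqrt hpos.le, inv_mul_cancel₀ hpos.ne']
  · rw [autocorr_const_mul, autocorr_sin_one, inv_pow, Real.sq_sqrt hpos.le, mul_left_comm]
    exact (congrArg _ (inv_mul_cancel₀ hpos.ne')).trans (mul_one _)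

theorem abs_le_pi_mul_abs_sin_half {y : ℝ} (hy : |y| ≤ Real.pi) :
    |y| ≤ Real.pi * |Real.sin (y / 2)| := by
  have h := Real.mul_abs_le_abs_sin (x := y / 2) (by
    rw [abs_div, abs_of_pos (by norm_num : (0:ℝ) < 2)]; linarith)
  rw [abs_div, abs_of_pos (by norm_num : (0:ℝ) < 2)] at h
  calc |y| = Real.pi * (2 / Real.pi * (|y| / 2)) := by field_simp
    _ ≤ _ := by gcongr

theorem exists_abs_sub_int_mul_two_pi_le (x : ℝ) :
    ∃ k : ℤ, |x - k * (2 * Real.pi)| ≤ Real.pi := by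
  refine ⟨round (x / (2 * Real.pi)), ?_⟩
  have h := abs_sub_round (x / (2 * Real.pi))
  have hp := Real.pi_pos
  have e : x - round (x / (2 * Real.pi)) * (2 * Real.pi) =
      (x / (2 * Real.pi) - round (x / (2 * Real.pi))) * (2 * Real.pi) := by
    field_simp
  rw [e, abs_mul, abs_of_pos Real.two_pi_pos]
  nlinarith

/-- By periodicity `x - t` may be moved into `[-π, π]`, where Jordan's inequality bounds it by the
sine of its half. -/
theorem abs_sub_le_of_periodic_of_lipschitz {f : ℝ → ℝ} (hper : Function.Periodic f (2 * Real.pi))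
    {M : ℝ} (hM : 0 ≤ M) (hL : ∀ x y, |f x - f y| ≤ M * |x - y|) (x t : ℝ) :
    |f t - f x| ≤ M * (Real.pi * |Real.sin ((x - t) / 2)|) := by
  obtain ⟨m, hm⟩ := exists_abs_sub_int_mul_two_pi_le (x - t)
  have h1 : f (x - m * (2 * Real.pi)) = f x := hper.sub_int_mul_eq m
  rw [← h1, abs_sub_comm]
  refine (hL _ _).trans (mul_le_mul_of_nonneg_left ?_ hM)
  have e : x - m * (2 * Real.pi) - t = x - t - m * (2 * Real.pi) := by ring
  rw [e]
  refine (abs_le_pi_mul_abs_sin_half hm).trans_eq ?_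
  have e2 : (x - t - m * (2 * Real.pi)) / 2 = (x - t) / 2 - m * Real.pi := by ring
  rw [e2, Real.sin_sub_int_mul_pi, abs_mul, abs_zpow, abs_neg, abs_one, one_zpow, one_mul]

theorem squareMean_cos (N : ℕ) (b : ℕ → ℝ) (x : ℝ) :
    squareMean N b (fun t => Real.cos (x - t)) x = autocorr N b 1 := by
  have h := congrFun (squareMean_trigPoly N b 1 (Pi.single 1 (Real.cos x))
    (Pi.single 1 (Real.sin x))) x
  have e : (fun t => Real.cos (x - t)) =
      trigPoly 1 (Pi.single 1 (Real.cos x)) (Pi.single 1 (Real.sin x)) := by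
    ext t; simp [trigPoly, Finset.sum_range_succ, Real.cos_sub]
  rw [e, h]
  simp only [trigPoly, Finset.sum_range_succ]
  simp
  linear_combination (autocorr N b 1) * Real.cos_sq_add_sin_sq x

/-- Jackson's estimate for the Fejér–Korovkin means of a Lipschitz function. -/
theorem abs_squareMean_sub_self_le {L : ℕ} {b : ℕ → ℝ} (hb0 : autocorr (L + 1) b 0 = 1)
    (hb1 : autocorr (L + 1) b 1 = Real.cos (Real.pi / (L + 2))) {f : ℝ → ℝ} (hf : Continuous f)
    (hper : Function.Periodic f (2 * Real.pi)) {M : ℝ} (hM : 0 ≤ M)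
    (hL : ∀ x y, |f x - f y| ≤ M * |x - y|) (x : ℝ) :
    |squareMean (L + 1) b f x - f x| ≤ M * (Real.pi ^ 2 / (2 * (L + 2))) := by
  have hW := continuous_squareKernel (L + 1) b
  have hpi := Real.pi_pos
  -- With `s = |sin ((x - t) / 2)|`, the kernel average of `s² = (1 - cos (x - t)) / 2` is exactly
  -- `ε²`. Hence `s ≤ s² / (2ε) + ε / 2` is the optimal splitting and averages to `ε`.
  set ε := Real.sin (Real.pi / (L + 2) / 2) with hε
  have hθ : 0 < Real.pi / (L + 2) / 2 := by positivity
  have hθ' : Real.pi / (L + 2) / 2 < Real.pi := by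
    rw [div_div]
    exact div_lt_self hpi (by linarith [(Nat.cast_nonneg L : (0:ℝ) ≤ L)])
  have hεpos : 0 < ε := Real.sin_pos_of_pos_of_lt_pi hθ hθ'
  have hεle : ε ≤ Real.pi / (L + 2) / 2 := Real.sin_le hθ.le
  have hpt : ∀ t, |(f t - f x) * squareKernel (L + 1) b (x - t)| ≤
      M * Real.pi * ((1 / (4 * ε) + ε / 2) * squareKernel (L + 1) b (x - t) -
        (1 / (4 * ε)) * (Real.cos (x - t) * squareKernel (L + 1) b (x - t))) := by
    intro t
    have h0 := squareKernel_nonneg (L + 1) b (x - t)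
    have hs : |Real.sin ((x - t) / 2)| ≤ (1 / (4 * ε)) * (1 - Real.cos (x - t)) + ε / 2 := by
      have h1 : 1 - Real.cos (x - t) = 2 * |Real.sin ((x - t) / 2)| ^ 2 := by
        have := Real.cos_sq' ((x - t) / 2)
        have h2 := Real.cos_two_mul ((x - t) / 2)
        rw [show 2 * ((x - t) / 2) = x - t by ring] at h2
        rw [sq_abs, h2, this]; ring
      rw [h1]
      generalize |Real.sin ((x - t) / 2)| = s
      have : 1 / (4 * ε) * (2 * s ^ 2) + ε / 2 - s = (s - ε) ^ 2 / (2 * ε) := by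
        field_simp; ring
      have : 0 ≤ (s - ε) ^ 2 / (2 * ε) := by positivity
      linarith
    rw [abs_mul, abs_of_nonneg h0]
    calc _ ≤ M * (Real.pi * |Real.sin ((x - t) / 2)|) * squareKernel (L + 1) b (x - t) := by
          gcongr
          exact abs_sub_le_of_periodic_of_lipschitz hper hM hL x t
      _ ≤ M * (Real.pi * ((1 / (4 * ε)) * (1 - Real.cos (x - t)) + ε / 2)) *
            squareKernel (L + 1) b (x - t) := by gcongr
      _ = _ := by ring
  have hdiff : squareMean (L + 1) b f x - f x = (1 / (2 * Real.pi)) *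
      ∫ t in (-Real.pi)..Real.pi, (f t - f x) * squareKernel (L + 1) b (x - t) := by
    have := squareMean_sub (L + 1) b hf (continuous_const (y := f x)) x
    have h2 : squareMean (L + 1) b (fun _ => f x) x = f x := by
      have := integral_squareKernel_sub (L + 1) b x
      unfold squareMean
      rw [intervalIntegral.integral_const_mul, mul_left_comm, this, hb0, mul_one]
    rw [h2] at this
    rw [← this]; rfl
  have hcos := squareMean_cos (L + 1) b x
  have hone := integral_squareKernel_sub (L + 1) b x
  unfold squareMean at hcos
  rw [hdiff, abs_mul, abs_of_pos (by positivity : 0 < 1 / (2 * Real.pi))]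
  have hint : |∫ t in (-Real.pi)..Real.pi, (f t - f x) * squareKernel (L + 1) b (x - t)| ≤
      ∫ t in (-Real.pi)..Real.pi, M * Real.pi * ((1 / (4 * ε) + ε / 2) *
        squareKernel (L + 1) b (x - t) -
        (1 / (4 * ε)) * (Real.cos (x - t) * squareKernel (L + 1) b (x - t))) := by
    refine intervalIntegral.norm_integral_le_of_norm_le
      (f := fun t => (f t - f x) * squareKernel (L + 1) b (x - t)) (by linarith)
      (Filter.Eventually.of_forall fun t _ => hpt t) ?_
    exact Continuous.intervalIntegrable (by fun_prop) _ _
  have hi1 : IntervalIntegrable (fun t => (1 / (4 * ε) + ε / 2) * squareKernel (L + 1) b (x - t))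
      MeasureTheory.volume (-Real.pi) Real.pi :=
    Continuous.intervalIntegrable (by fun_prop) _ _
  have hi2 : IntervalIntegrable (fun t => (1 / (4 * ε)) *
      (Real.cos (x - t) * squareKernel (L + 1) b (x - t)))
      MeasureTheory.volume (-Real.pi) Real.pi :=
    Continuous.intervalIntegrable (by fun_prop) _ _
  rw [intervalIntegral.integral_const_mul, intervalIntegral.integral_sub hi1 hi2,
    intervalIntegral.integral_const_mul, intervalIntegral.integral_const_mul] at hint
  have hcosθ : 1 - Real.cos (Real.pi / (L + 2)) = 2 * ε ^ 2 := by
    have := Real.cos_sq' (Real.pi / (L + 2) / 2)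
    have h2 := Real.cos_two_mul (Real.pi / (L + 2) / 2)
    rw [show 2 * (Real.pi / (L + 2) / 2) = Real.pi / (L + 2) by ring] at h2
    rw [h2, this, hε]; ring
  calc _ ≤ _ := mul_le_mul_of_nonneg_left hint (by positivity)
    _ = M * Real.pi * ((1 / (4 * ε) + ε / 2) * autocorr (L + 1) b 0
          - (1 / (4 * ε)) * autocorr (L + 1) b 1) := by
        rw [← hone, ← hcos]; ring
    _ = M * Real.pi * ((1 / (4 * ε)) * (1 - Real.cos (Real.pi / (L + 2))) + ε / 2) := by
        rw [hb0, hb1]; ring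
    _ = M * Real.pi * ε := by
        rw [hcosθ]; field_simp; ring
    _ ≤ M * Real.pi * (Real.pi / (L + 2) / 2) := by gcongr
    _ = _ := by field_simp

/-! ### Means commute with translations and preserve Lipschitz bounds -/

theorem freqPart_comp_add (j : ℤ) {f : ℝ → ℝ} (hper : Function.Periodic f (2 * Real.pi))
    (s x : ℝ) : freqPart j (fun t => f (t + s)) x = freqPart j f (x + s) := by
  unfold freqPart
  congr 1
  have h1 := intervalIntegral.integral_comp_add_right (a := -Real.pi) (b := Real.pi)
    (fun t => f t * Real.cos (j * (x + s - t))) s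
  have hp : Function.Periodic (fun t => f t * Real.cos (j * (x + s - t))) (2 * Real.pi) := by
    intro t
    have e : (j : ℝ) * (x + s - (t + 2 * Real.pi)) = j * (x + s - t) - j * (2 * Real.pi) := by ring
    simp only [hper t, e, Real.cos_sub_int_mul_two_pi]
  have h2 := hp.intervalIntegral_add_eq (-Real.pi + s) (-Real.pi)
  rw [show -Real.pi + s + 2 * Real.pi = Real.pi + s by ring,
    show -Real.pi + 2 * Real.pi = Real.pi by ring] at h2
  rw [← h2, ← h1]
  congr 1; ext t
  rw [show x + s - (t + s) = x - t by ring]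

theorem squareMean_comp_add (N : ℕ) (b : ℕ → ℝ) {f : ℝ → ℝ} (hf : Continuous f)
    (hper : Function.Periodic f (2 * Real.pi)) (s x : ℝ) :
    squareMean N b (fun t => f (t + s)) x = squareMean N b f (x + s) := by
  rw [squareMean_eq_sum _ _ (by fun_prop), squareMean_eq_sum _ _ hf]
  simp_rw [freqPart_comp_add _ hper]

theorem abs_squareMean_sub_squareMean_le (N : ℕ) (b : ℕ → ℝ) {f : ℝ → ℝ} (hf : Continuous f)
    (hper : Function.Periodic f (2 * Real.pi)) {M : ℝ}
    (hL : ∀ x y, |f x - f y| ≤ M * |x - y|) (x y : ℝ) :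
    |squareMean N b f x - squareMean N b f y| ≤ autocorr N b 0 * (M * |x - y|) := by
  have h1 := squareMean_comp_add N b hf hper (x - y) y
  rw [add_sub_cancel] at h1
  rw [← h1, ← squareMean_sub N b (by fun_prop) hf]
  refine abs_squareMean_le N b (fun t => (hL _ _).trans_eq ?_) y
  rw [add_sub_cancel_left]

/-! ### Convex multipliers and the inversion of derivatives -/

/-- The tangent line of `x ↦ x ^ (-m)` at `i`. -/
noncomputable def tangentLine (m i : ℕ) (x : ℝ) : ℝ :=
  ((i : ℝ) ^ m)⁻¹ * (1 - m * (x / i - 1))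

/-- A convex function lies above its tangents; here this is Bernoulli's inequality for `(i / j) ^ m`
together with `i / j + j / i ≥ 2`. -/
theorem tangentLine_le {m i j : ℕ} (hi : 1 ≤ i) (hj : 1 ≤ j) :
    tangentLine m i j ≤ ((j : ℝ) ^ m)⁻¹ := by
  have hi' : (0 : ℝ) < i := by positivity
  have hj' : (0 : ℝ) < j := by positivity
  have h1 := one_add_mul_le_pow (a := (i : ℝ) / j - 1) (by
    have : (0 : ℝ) ≤ i / j := by positivity
    linarith) m
  have h2 : 1 - m * ((j : ℝ) / i - 1) ≤ 1 + m * ((i : ℝ) / j - 1) := by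
    have : 0 ≤ ((i : ℝ) / j - 1) + ((j : ℝ) / i - 1) := by
      have : ((i : ℝ) / j - 1) + ((j : ℝ) / i - 1) = (i - j) ^ 2 / (i * j) := by
        field_simp; ring
      rw [this]; positivity
    nlinarith [(Nat.cast_nonneg m : (0 : ℝ) ≤ m)]
  have h3 : 1 - m * ((j : ℝ) / i - 1) ≤ ((i : ℝ) / j) ^ m :=
    h2.trans (h1.trans_eq (by ring))
  unfold tangentLine
  rw [inv_mul_le_iff₀ (by positivity)]
  rwa [div_pow, div_eq_mul_inv] at h3

theorem tangentLine_self {m i : ℕ} (hi : 1 ≤ i) : tangentLine m i i = ((i : ℝ) ^ m)⁻¹ := by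
  have hi' : (i : ℝ) ≠ 0 := by positivity
  simp [tangentLine, hi']

theorem tangentLine_zero (m i : ℕ) : tangentLine m i 0 = (m + 1) * ((i : ℝ) ^ m)⁻¹ := by
  simp [tangentLine]; ring

theorem tangentLine_nonpos {m i : ℕ} (hm : 1 ≤ m) (hi : 1 ≤ i) {x : ℝ} (hx : 2 * (i : ℝ) ≤ x) :
    tangentLine m i x ≤ 0 := by
  have hi' : (0 : ℝ) < i := by positivity
  have hm' : (1 : ℝ) ≤ m := by exact_mod_cast hm
  have : 2 ≤ x / i := by rwa [le_div_iff₀ hi']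
  refine mul_nonpos_of_nonneg_of_nonpos (by positivity) ?_
  nlinarith

theorem tangentLine_add_tangentLine (m i : ℕ) (x : ℝ) :
    tangentLine m i x + tangentLine m i (x + 2) = 2 * tangentLine m i (x + 1) := by
  unfold tangentLine; ring

/-- A convex, eventually vanishing sequence that agrees with `j ^ (-m)` on `[N, L]`. -/
theorem exists_convex_seq {m N L : ℕ} (hm : 1 ≤ m) (hN : 1 ≤ N) :
    ∃ (a : ℕ → ℝ) (J : ℕ), (∀ j, 0 ≤ a j - 2 * a (j + 1) + a (j + 2)) ∧ (∀ j, J ≤ j → a j = 0) ∧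
      (∀ j, N ≤ j → j ≤ L → a j = ((j : ℝ) ^ m)⁻¹) ∧ a 0 ≤ (m + 1) * ((N : ℝ) ^ m)⁻¹ := by
  -- The sequence is the maximum of the tangent lines at `N, …, L` and of the zero function, for
  -- which the index `0` stands. All these tangents are nonpositive from `2 * L` on.
  set S : Finset ℕ := insert 0 (Finset.Icc N L) with hS
  have hSne : S.Nonempty := ⟨0, by simp [hS]⟩
  set τ : ℕ → ℝ → ℝ := fun i x => if i = 0 then 0 else tangentLine m i x with hτ
  have hle : ∀ i ∈ S, ∀ x, τ i x ≤ S.sup' hSne fun i => τ i x :=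
    fun i hi x => Finset.le_sup' (fun i => τ i x) hi
  have hlin : ∀ i x, τ i x + τ i (x + 2) = 2 * τ i (x + 1) := by
    intro i x
    simp only [hτ]
    split_ifs
    · simp
    · exact tangentLine_add_tangentLine m i x
  have hnonneg : ∀ x, 0 ≤ S.sup' hSne fun i => τ i x := by
    intro x
    have := hle 0 (by simp [hS]) x
    simpa [hτ] using this
  have hcases : ∀ i ∈ S, i = 0 ∨ (i ≠ 0 ∧ N ≤ i ∧ i ≤ L) := by
    intro i hi
    simp only [hS, Finset.mem_insert, Finset.mem_Icc] at hi
    omega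
  refine ⟨fun j => S.sup' hSne fun i => τ i j, 2 * L, fun j => ?_, fun j hj => ?_,
    fun j hj hj' => ?_, ?_⟩
  -- The line attaining the maximum at `j + 1` lies below the sequence at `j` and `j + 2`.
  · obtain ⟨i, hi, h⟩ := Finset.exists_mem_eq_sup' hSne fun i => τ i ((j + 1 : ℕ) : ℝ)
    simp only [h]
    have h1 := hle i hi j
    have h2 := hle i hi ((j + 2 : ℕ) : ℝ)
    have h3 := hlin i j
    push_cast at *
    linarith
  · refine le_antisymm (Finset.sup'_le _ _ fun i hi => ?_) (hnonneg _)
    rcases hcases i hi with rfl | ⟨h0, h1, h2⟩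
    · simp [hτ]
    · simp only [hτ, h0, if_false]
      refine tangentLine_nonpos hm (by omega) ?_
      have : 2 * i ≤ j := by omega
      exact_mod_cast this
  · refine le_antisymm (Finset.sup'_le _ _ fun i hi => ?_) ?_
    · rcases hcases i hi with rfl | ⟨h0, h1, h2⟩
      · simp [hτ]
      · simp only [hτ, h0, if_false]
        exact tangentLine_le (by omega) (by omega)
    · have := hle j (by simp [hS, hj, hj']) j
      have h0 : j ≠ 0 := by omega
      simp only [hτ, h0, if_false, tangentLine_self (by omega : 1 ≤ j)] at this
      exact this
  · refine Finset.sup'_le _ _ fun i hi => ?_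
    rcases hcases i hi with rfl | ⟨h0, h1, h2⟩
    · simp only [hτ, if_true]; positivity
    · simp only [hτ, h0, if_false, Nat.cast_zero, tangentLine_zero]
      gcongr

/-- Two summations by parts. The truncated difference `j + 1 - l` is the `l`-th multiplier of
`squareMean (j + 1) 1`, so this expands `a` in Fejér multipliers. -/
theorem sum_secondDiff_mul (a : ℕ → ℝ) (l J : ℕ) (hl : l ≤ J) :
    ∑ j ∈ Finset.range J, (a j - 2 * a (j + 1) + a (j + 2)) * ((j + 1 - l : ℕ) : ℝ) =
      a l - ((J + 1 - l : ℕ) : ℝ) * a J + ((J - l : ℕ) : ℝ) * a (J + 1) := by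
  induction J, hl using Nat.le_induction with
  | base =>
    simp only [Nat.sub_self, Nat.add_sub_cancel_left, Nat.cast_zero, Nat.cast_one]
    rw [Finset.sum_eq_zero]
    · ring
    · intro j hj
      rw [Finset.mem_range] at hj
      rw [Nat.sub_eq_zero_of_le (by omega)]; simp
  | succ J hJ ih =>
    rw [Finset.sum_range_succ, ih, Nat.cast_sub (by omega), Nat.cast_sub (by omega),
      Nat.cast_sub (by omega)]
    push_cast
    ring

theorem sum_secondDiff_mul_of_eventually_zero {a : ℕ → ℝ} {J : ℕ} (hJ : ∀ j, J ≤ j → a j = 0)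
    (l : ℕ) :
    ∑ j ∈ Finset.range J, (a j - 2 * a (j + 1) + a (j + 2)) * ((j + 1 - l : ℕ) : ℝ) = a l := by
  rcases le_total l J with h | h
  · rw [sum_secondDiff_mul a l J h, hJ J le_rfl, hJ (J + 1) (by omega)]; ring
  · rw [hJ l h, Finset.sum_eq_zero]
    intro j hj
    rw [Finset.mem_range] at hj
    rw [Nat.sub_eq_zero_of_le (by omega)]; simp

/-- Convolution with the Fejér-type kernel with cosine coefficients `a`, on trigonometric
polynomials. -/
theorem sum_secondDiff_mul_squareMean {a : ℕ → ℝ} {J : ℕ} (hJ : ∀ j, J ≤ j → a j = 0)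
    (L : ℕ) (α β : ℕ → ℝ) (x : ℝ) :
    ∑ j ∈ Finset.range J, (a j - 2 * a (j + 1) + a (j + 2)) *
      squareMean (j + 1) 1 (trigPoly L α β) x =
      trigPoly L (fun l => a l * α l) (fun l => a l * β l) x := by
  simp_rw [squareMean_trigPoly, trigPoly, Finset.mul_sum]
  rw [Finset.sum_comm]
  refine Finset.sum_congr rfl fun l _ => ?_
  rw [← sum_secondDiff_mul_of_eventually_zero hJ l]
  simp_rw [autocorr_one, Finset.sum_mul, ← Finset.sum_add_distrib]
  exact Finset.sum_congr rfl fun j _ => by ring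

/-- Convexity makes all weights nonnegative, so the norms `j + 1` add up to `∑ Δ²a j * (j + 1) = a
0`. -/
theorem abs_sum_secondDiff_mul_squareMean_le {a : ℕ → ℝ} {J : ℕ}
    (ha : ∀ j, 0 ≤ a j - 2 * a (j + 1) + a (j + 2)) (hJ : ∀ j, J ≤ j → a j = 0)
    {f : ℝ → ℝ} {B : ℝ} (hB : ∀ x, |f x| ≤ B) (x : ℝ) :
    |∑ j ∈ Finset.range J, (a j - 2 * a (j + 1) + a (j + 2)) * squareMean (j + 1) 1 f x| ≤
      a 0 * B := by
  rw [← sum_secondDiff_mul_of_eventually_zero hJ 0, Finset.sum_mul]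
  refine (Finset.abs_sum_le_sum_abs _ _).trans (Finset.sum_le_sum fun j _ => ?_)
  rw [abs_mul, abs_of_nonneg (ha j), mul_assoc]
  refine mul_le_mul_of_nonneg_left ?_ (ha j)
  have := abs_squareMean_le (j + 1) 1 hB x
  rwa [autocorr_one] at this

/-- A trigonometric polynomial whose derivative of order `2p` (up to sign) is approximated up to
`B` by trigonometric polynomials of degree `n` is itself approximated up to
`(2p+1) (n+1) ^ (-2p) B`. -/
theorem exists_approx_of_approx_pow_mul {p n L : ℕ} {α β : ℕ → ℝ} {q₀ : ℝ → ℝ}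
    (hq₀ : q₀ ∈ trigSpace n) {B : ℝ}
    (hB : ∀ x, |trigPoly L (fun l => (-1) ^ p * (l : ℝ) ^ (2 * p) * α l)
      (fun l => (-1) ^ p * (l : ℝ) ^ (2 * p) * β l) x - q₀ x| ≤ B) :
    ∃ q ∈ trigSpace n, ∀ x, |trigPoly L α β x - q x| ≤
      (2 * p + 1) * (((n : ℝ) + 1) ^ (2 * p))⁻¹ * B := by
  rcases Nat.eq_zero_or_pos p with rfl | hp
  · refine ⟨q₀, hq₀, fun x => ?_⟩
    simpa using hB x
  have hB0 : 0 ≤ B := (abs_nonneg _).trans (hB 0)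
  -- Agreement with `l ^ (-2p)` is needed only for `n < l ≤ L`: whatever the multiplier does to
  -- lower frequencies stays in `trigSpace n` and is absorbed into the approximant.
  obtain ⟨a, J, ha, hJ, haL, ha0⟩ := exists_convex_seq (m := 2 * p) (N := n + 1) (L := L)
    (by omega) (by omega)
  obtain ⟨γ, δ, rfl⟩ := hq₀
  set α' : ℕ → ℝ := fun l => (-1) ^ p * (l : ℝ) ^ (2 * p) * α l with hα'
  set β' : ℕ → ℝ := fun l => (-1) ^ p * (l : ℝ) ^ (2 * p) * β l with hβ'
  have hs : ((-1 : ℝ) ^ p) * (-1) ^ p = 1 := by rw [← mul_pow]; simp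
  have key : ∀ x, ((-1) ^ p) * ∑ j ∈ Finset.range J, (a j - 2 * a (j + 1) + a (j + 2)) *
      squareMean (j + 1) 1 (fun x => trigPoly L α' β' x - trigPoly n γ δ x) x =
      trigPoly L (fun l => a l * (l : ℝ) ^ (2 * p) * α l)
        (fun l => a l * (l : ℝ) ^ (2 * p) * β l) x -
      (-1) ^ p * trigPoly n (fun l => a l * γ l) (fun l => a l * δ l) x := by
    intro x
    simp_rw [squareMean_sub _ _ (continuous_trigPoly _ _ _) (continuous_trigPoly _ _ _), mul_sub,
      Finset.sum_sub_distrib, sum_secondDiff_mul_squareMean hJ, mul_sub]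
    congr 1
    simp only [trigPoly, hα', hβ', Finset.mul_sum]
    refine Finset.sum_congr rfl fun l _ => ?_
    linear_combination (a l * (l : ℝ) ^ (2 * p) * α l * Real.cos (l * x) +
      a l * (l : ℝ) ^ (2 * p) * β l * Real.sin (l * x)) * hs
  have hmem : (fun x => trigPoly L α β x - trigPoly L (fun l => a l * (l : ℝ) ^ (2 * p) * α l)
        (fun l => a l * (l : ℝ) ^ (2 * p) * β l) x) ∈ trigSpace n := by
    have : (fun x => trigPoly L α β x - trigPoly L (fun l => a l * (l : ℝ) ^ (2 * p) * α l)
        (fun l => a l * (l : ℝ) ^ (2 * p) * β l) x) =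
        ∑ l ∈ Finset.range (L + 1), (((1 - a l * (l : ℝ) ^ (2 * p)) * α l) •
          (fun x : ℝ => Real.cos (l * x)) +
          ((1 - a l * (l : ℝ) ^ (2 * p)) * β l) • (fun x : ℝ => Real.sin (l * x))) := by
      ext x
      simp only [trigPoly, Finset.sum_apply, Pi.add_apply, Pi.smul_apply, smul_eq_mul,
        ← Finset.sum_sub_distrib]
      exact Finset.sum_congr rfl fun l _ => by ring
    rw [this]
    refine sum_mem fun l hl => ?_
    rw [Finset.mem_range] at hl
    rcases le_or_gt l n with h | h
    · exact add_mem (Submodule.smul_mem _ _ (cos_natCast_mul_mem_trigSpace h))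
        (Submodule.smul_mem _ _ (sin_natCast_mul_mem_trigSpace h))
    · have hl0 : (l : ℝ) ^ (2 * p) ≠ 0 := by
        have : 0 < l := by omega
        positivity
      rw [haL l (by omega) (by omega), inv_mul_cancel₀ hl0]
      simp
  refine ⟨fun x => (trigPoly L α β x - trigPoly L (fun l => a l * (l : ℝ) ^ (2 * p) * α l)
        (fun l => a l * (l : ℝ) ^ (2 * p) * β l) x) +
        (-1) ^ p * trigPoly n (fun l => a l * γ l) (fun l => a l * δ l) x,
    add_mem hmem (Submodule.smul_mem _ ((-1) ^ p) (trigPoly_mem_trigSpace _ _ _)), fun x => ?_⟩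
  have e := key x
  have hb := abs_sum_secondDiff_mul_squareMean_le ha hJ hB x
  calc _ = |((-1) ^ p) * ∑ j ∈ Finset.range J, (a j - 2 * a (j + 1) + a (j + 2)) *
      squareMean (j + 1) 1 (fun x => trigPoly L α' β' x - trigPoly n γ δ x) x| := by
        rw [e]; congr 1; ring
    _ ≤ a 0 * B := by
        rw [abs_mul, abs_pow, abs_neg, abs_one, one_pow, one_mul]; exact hb
    _ ≤ _ := by
        refine mul_le_mul_of_nonneg_right (ha0.trans_eq ?_) hB0
        push_cast; ring

/-! ### Derivatives of means and of trigonometric polynomials -/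

/-- Integration by parts; the boundary terms cancel by periodicity for the cosine and vanish for the
sine. -/
theorem hasDerivAt_freqPart {f : ℝ → ℝ} (hf : ContDiff ℝ 1 f)
    (hper : Function.Periodic f (2 * Real.pi)) (j : ℤ) (x : ℝ) :
    HasDerivAt (freqPart j f) (freqPart j (deriv f) x) x := by
  have hd : Continuous (deriv f) := hf.continuous_deriv le_rfl
  have hdf : ∀ t, HasDerivAt f (deriv f t) t := fun t =>
    (hf.differentiable one_ne_zero t).hasDerivAt
  have hend : f Real.pi = f (-Real.pi) := by
    have := hper (-Real.pi)
    rwa [show -Real.pi + 2 * Real.pi = Real.pi by ring] at this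
  have hcos : ∀ t, HasDerivAt (fun t : ℝ => Real.cos (j * t)) (-Real.sin (j * t) * j) t := by
    intro t
    simpa using ((hasDerivAt_id t).const_mul (j : ℝ)).cos
  have hsin : ∀ t, HasDerivAt (fun t : ℝ => Real.sin (j * t)) (Real.cos (j * t) * j) t := by
    intro t
    simpa using ((hasDerivAt_id t).const_mul (j : ℝ)).sin
  have h1 := intervalIntegral.integral_mul_deriv_eq_deriv_mul (a := -Real.pi) (b := Real.pi)
    (fun t _ => hdf t) (fun t _ => hcos t) (hd.intervalIntegrable _ _)
    (Continuous.intervalIntegrable (by fun_prop) _ _)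
  have h2 := intervalIntegral.integral_mul_deriv_eq_deriv_mul (a := -Real.pi) (b := Real.pi)
    (fun t _ => hdf t) (fun t _ => hsin t) (hd.intervalIntegrable _ _)
    (Continuous.intervalIntegrable (by fun_prop) _ _)
  have e1 : ∫ t in (-Real.pi)..Real.pi, f t * (-Real.sin (j * t) * j) =
      -j * ∫ t in (-Real.pi)..Real.pi, f t * Real.sin (j * t) := by
    rw [← intervalIntegral.integral_const_mul]; congr 1; ext t; ring
  have e2 : ∫ t in (-Real.pi)..Real.pi, f t * (Real.cos (j * t) * j) =
      j * ∫ t in (-Real.pi)..Real.pi, f t * Real.cos (j * t) := by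
    rw [← intervalIntegral.integral_const_mul]; congr 1; ext t; ring
  rw [e1, hend] at h1
  rw [e2, hend] at h2
  simp only [mul_neg, Real.cos_neg, Real.sin_neg, Real.sin_int_mul_pi, sub_self, neg_zero,
    mul_zero, zero_sub] at h1 h2
  rw [funext (freqPart_eq hf.continuous j), freqPart_eq hd]
  have h3 := (((hcos x).mul_const (∫ t in (-Real.pi)..Real.pi, f t * Real.cos (j * t))).add
    ((hsin x).mul_const (∫ t in (-Real.pi)..Real.pi, f t * Real.sin (j * t)))).const_mul
    (1 / (2 * Real.pi))
  refine h3.congr_deriv ?_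
  rw [← neg_eq_iff_eq_neg.mpr h1, ← neg_eq_iff_eq_neg.mpr h2]
  ring

theorem deriv_squareMean (N : ℕ) (b : ℕ → ℝ) {f : ℝ → ℝ} (hf : ContDiff ℝ 1 f)
    (hper : Function.Periodic f (2 * Real.pi)) :
    deriv (squareMean N b f) = squareMean N b (deriv f) := by
  ext x
  rw [squareMean_eq_sum _ _ (hf.continuous_deriv le_rfl),
    funext (squareMean_eq_sum N b hf.continuous)]
  refine HasDerivAt.deriv (HasDerivAt.fun_sum fun k _ => HasDerivAt.fun_sum fun k' _ => ?_)
  exact (hasDerivAt_freqPart hf hper _ x).const_mul _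

theorem periodic_deriv {f : ℝ → ℝ} {c : ℝ} (h : Function.Periodic f c) :
    Function.Periodic (deriv f) c := by
  intro x
  rw [← deriv_comp_add_const, funext h]

theorem periodic_iteratedDeriv {f : ℝ → ℝ} {c : ℝ} (h : Function.Periodic f c) (m : ℕ) :
    Function.Periodic (iteratedDeriv m f) c := by
  induction m with
  | zero => simpa using h
  | succ m ih => rw [iteratedDeriv_succ]; exact periodic_deriv ih

theorem iteratedDeriv_squareMean (N : ℕ) (b : ℕ → ℝ) (m : ℕ) {f : ℝ → ℝ} (hf : ContDiff ℝ m f)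
    (hper : Function.Periodic f (2 * Real.pi)) :
    iteratedDeriv m (squareMean N b f) = squareMean N b (iteratedDeriv m f) := by
  induction m generalizing f with
  | zero => simp
  | succ m ih =>
    have h1 : ContDiff ℝ 1 f := hf.of_le (by exact_mod_cast Nat.le_add_left 1 m)
    have h2 : ContDiff ℝ m (deriv f) := by
      have : ContDiff ℝ ((m : WithTop ℕ∞) + 1) f := by exact_mod_cast hf
      exact (contDiff_succ_iff_deriv.mp this).2.2
    rw [iteratedDeriv_succ', deriv_squareMean N b h1 hper, ih h2 (periodic_deriv hper),
      iteratedDeriv_succ']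

theorem deriv_trigPoly (L : ℕ) (α β : ℕ → ℝ) :
    deriv (trigPoly L α β) = trigPoly L (fun l => l * β l) (fun l => -(l * α l)) := by
  ext x
  refine HasDerivAt.deriv ?_
  refine HasDerivAt.fun_sum fun l _ => ?_
  have hl : HasDerivAt (fun t : ℝ => (l : ℝ) * t) l x := by
    simpa using (hasDerivAt_id x).const_mul (l : ℝ)
  exact ((hl.cos.const_mul (α l)).add (hl.sin.const_mul (β l))).congr_deriv (by ring)

/-- Only even orders act as a multiplier on the cosine and sine coefficients; odd orders exchange
the two, which is why `approxConst` depends on parity. -/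
theorem iteratedDeriv_two_mul_trigPoly (L p : ℕ) (α β : ℕ → ℝ) :
    iteratedDeriv (2 * p) (trigPoly L α β) =
      trigPoly L (fun l => (-1) ^ p * (l : ℝ) ^ (2 * p) * α l)
        (fun l => (-1) ^ p * (l : ℝ) ^ (2 * p) * β l) := by
  induction p with
  | zero => simp
  | succ p ih =>
    rw [show 2 * (p + 1) = 2 * p + 1 + 1 by ring, iteratedDeriv_succ, iteratedDeriv_succ, ih,
      deriv_trigPoly, deriv_trigPoly]
    congr 1 <;> ext l <;> ring

theorem periodic_trigPoly (L : ℕ) (α β : ℕ → ℝ) :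
    Function.Periodic (trigPoly L α β) (2 * Real.pi) := by
  intro x
  unfold trigPoly
  refine Finset.sum_congr rfl fun l _ => ?_
  rw [mul_add, Real.cos_add_nat_mul_two_pi, Real.sin_add_nat_mul_two_pi]

/-! ### Jackson's theorem for a Lipschitz derivative -/

/-- The constant in the approximation of functions whose `η`-th derivative is Lipschitz. -/
noncomputable def approxConst (η n : ℕ) : ℝ :=
  if Even η then (η + 1) * (((n : ℝ) + 1) ^ η)⁻¹ * (Real.pi ^ 2 / (2 * (n + 2)))
  else (η + 2) * (((n : ℝ) + 1) ^ (η + 1))⁻¹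

/-- For even `η` the Lipschitz derivative of order `2p = η` is approximated by its Fejér–Korovkin
mean of degree `n`. For odd `η` the derivative of order `2p = η + 1` is bounded by `M`, and 0 serves
as its approximant. -/
theorem exists_trigSpace_approx_of_trigPoly {η n L : ℕ} {f : ℝ → ℝ} (hf : f ∈ trigSpace L) {M : ℝ}
    (hM : 0 ≤ M)
    (hL : ∀ x y, |iteratedDeriv η f x - iteratedDeriv η f y| ≤ M * |x - y|) :
    ∃ q ∈ trigSpace n, ∀ x, |f x - q x| ≤ approxConst η n * M := by
  obtain ⟨α, β, rfl⟩ := hf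
  unfold approxConst
  split_ifs with hη
  · obtain ⟨p, rfl⟩ := hη
    rw [← two_mul] at *
    rw [iteratedDeriv_two_mul_trigPoly] at hL
    obtain ⟨b, hb0, hb1⟩ := exists_korovkin_coeff n
    have hc := continuous_trigPoly L (fun l => (-1) ^ p * (l : ℝ) ^ (2 * p) * α l)
        (fun l => (-1) ^ p * (l : ℝ) ^ (2 * p) * β l)
    obtain ⟨q, hq, h⟩ := exists_approx_of_approx_pow_mul (squareMean_mem_trigSpace le_rfl b hc)
      (fun x => (abs_sub_comm _ _).trans_le
        (abs_squareMean_sub_self_le hb0 hb1 hc (periodic_trigPoly _ _ _) hM hL x))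
    refine ⟨q, hq, fun x => (h x).trans_eq ?_⟩
    push_cast
    ring
  · obtain ⟨p, rfl⟩ : ∃ p, η = 2 * p + 1 := by
      rw [Nat.not_even_iff_odd] at hη; exact hη
    have hB : ∀ x, |iteratedDeriv (2 * (p + 1)) (trigPoly L α β) x| ≤ M := by
      intro x
      rw [show 2 * (p + 1) = 2 * p + 1 + 1 by ring, iteratedDeriv_succ]
      have : LipschitzWith M.toNNReal (iteratedDeriv (2 * p + 1) (trigPoly L α β)) := by
        refine LipschitzWith.of_dist_le_mul fun x y => ?_
        rw [Real.coe_toNNReal _ hM]; exact hL x y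
      have h := norm_deriv_le_of_lipschitz this (x₀ := x)
      rwa [Real.coe_toNNReal _ hM] at h
    rw [iteratedDeriv_two_mul_trigPoly] at hB
    obtain ⟨q, hq, h⟩ := exists_approx_of_approx_pow_mul (q₀ := 0) (zero_mem (trigSpace n))
      (fun x => by simpa using hB x)
    refine ⟨q, hq, fun x => (h x).trans_eq ?_⟩
    push_cast
    ring

theorem exists_lipschitz_const {f : ℝ → ℝ} (hf : ContDiff ℝ 1 f) {c : ℝ} (hc : 0 < c)
    (hper : Function.Periodic f c) : ∃ C, 0 ≤ C ∧ ∀ x y, |f x - f y| ≤ C * |x - y| := by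
  obtain ⟨C, hC⟩ := isCompact_Icc.exists_bound_of_continuousOn (s := Set.Icc 0 c)
    (hf.continuous_deriv le_rfl).continuousOn
  have hC' : ∀ x, ‖deriv f x‖ ≤ C := by
    intro x
    obtain ⟨y, hy, h⟩ := (periodic_deriv hper).exists_mem_Ico₀ hc x
    rw [h]; exact hC y (Set.Ico_subset_Icc_self hy)
  refine ⟨C, (norm_nonneg _).trans (hC' 0), fun x y => ?_⟩
  exact Convex.norm_image_sub_le_of_norm_deriv_le
    (fun z _ => hf.differentiable one_ne_zero z) (fun z _ => hC' z) convex_univ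
    (Set.mem_univ y) (Set.mem_univ x)

/-- The de la Vallée-Poussin error for a periodic function with Lipschitz `η`-th derivative. -/
theorem abs_vpFourierSum_sub_self_le_approxConst {η : ℕ} {K : ℝ → ℝ} (hcont : ContDiff ℝ η K)
    (hper : Function.Periodic K (2 * Real.pi)) {M : ℝ} (hM : 0 ≤ M)
    (hL : ∀ x y, |iteratedDeriv η K x - iteratedDeriv η K y| ≤ M * |x - y|) {n : ℕ} (hn : 1 ≤ n)
    (r : ℝ) : |vpFourierSum n K r - K r| ≤ 4 * (approxConst η n * M) := by
  have hK := hcont.continuous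
  -- The size of `C` is irrelevant: it only ensures that the smoothed functions converge to `K`, and
  -- its term vanishes as `L → ∞`.
  obtain ⟨C, hC0, hC⟩ : ∃ C, 0 ≤ C ∧ ∀ x y, |K x - K y| ≤ C * |x - y| := by
    rcases Nat.eq_zero_or_pos η with rfl | h
    · exact ⟨M, hM, by simpa using hL⟩
    · exact exists_lipschitz_const (hcont.of_le (by exact_mod_cast h)) Real.two_pi_pos hper
  have hstep : ∀ L : ℕ, |vpFourierSum n K r - K r| ≤
      4 * (C * (Real.pi ^ 2 / (2 * (L + 2))) + approxConst η n * M) := by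
    intro L
    obtain ⟨b, hb0, hb1⟩ := exists_korovkin_coeff L
    have hmem := squareMean_mem_trigSpace (le_refl (L + 1)) b hK
    have hLip : ∀ x y, |iteratedDeriv η (squareMean (L + 1) b K) x -
        iteratedDeriv η (squareMean (L + 1) b K) y| ≤ M * |x - y| := by
      intro x y
      rw [iteratedDeriv_squareMean _ _ _ hcont hper]
      have := abs_squareMean_sub_squareMean_le (L + 1) b (hcont.continuous_iteratedDeriv' η)
        (periodic_iteratedDeriv hper η) hL x y
      rwa [hb0, one_mul] at this
    obtain ⟨q, hq, h⟩ := exists_trigSpace_approx_of_trigPoly (n := n) hmem hM hLip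
    refine abs_vpFourierSum_sub_self_le hK hn hq (fun x => ?_) r
    have h1 := abs_squareMean_sub_self_le hb0 hb1 hK hper hC0 hC x
    rw [abs_sub_comm] at h1
    exact (abs_sub_le _ _ _).trans (add_le_add h1 (h x))
  have hlim : Filter.Tendsto (fun L : ℕ => 4 * (C * (Real.pi ^ 2 / (2 * ((L : ℝ) + 2))) +
      approxConst η n * M)) Filter.atTop (nhds (4 * (C * 0 + approxConst η n * M))) := by
    refine (((Filter.Tendsto.const_div_atTop ?_ _).const_mul C).add_const _).const_mul 4
    exact (Filter.tendsto_atTop_add_const_right _ _ tendsto_natCast_atTop_atTop).const_mul_atTop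
      (by norm_num)
  have := ge_of_tendsto' hlim hstep
  simpa using this

/-! ### Comparison with the stated constants -/

theorem four_mul_approxConst_le {η n : ℕ} (hn : 1 ≤ n) {M : ℝ} (hM : 0 ≤ M) :
    4 * (approxConst η n * M) ≤ vpErrorBound η n M := by
  have hpi := Real.pi_pos
  have hpi2 := Real.pi_lt_d2
  have hpi3 : Real.pi ^ 3 ≤ 32 := by
    calc Real.pi ^ 3 ≤ 3.15 ^ 3 := by gcongr
      _ ≤ 32 := by norm_num
  have hn' : (0 : ℝ) < n := by positivity
  unfold vpErrorBound
  split_ifs with h0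
  · subst h0
    have hlog := Real.log_two_gt_d9
    have e1 : 4 * (approxConst 0 n * M) = 2 * Real.pi ^ 3 * M / (Real.pi * (n + 2)) := by
      simp [approxConst]; field_simp; ring
    have e2 : M / (n * Real.pi) * (58 + 32 * Real.log 2) =
        (58 + 32 * Real.log 2) * M / (Real.pi * n) := by
      field_simp
    rw [e1, e2]
    refine div_le_div₀ (by positivity) (mul_le_mul_of_nonneg_right ?_ hM) (by positivity) ?_
    · linarith
    · gcongr; linarith
  · unfold approxConst
    split_ifs with hη
    · have e1 : 4 * ((η + 1) * (((n : ℝ) + 1) ^ η)⁻¹ * (Real.pi ^ 2 / (2 * (n + 2))) * M) =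
          (2 * (η + 1) * Real.pi ^ 3) * M / (Real.pi * (n + 2) * ((n : ℝ) + 1) ^ η) := by
        field_simp; ring
      rw [e1]
      refine div_le_div₀ (by positivity) (mul_le_mul_of_nonneg_right ?_ hM) (by positivity) ?_
      -- From `π³ ≤ 32` the claim becomes `64 (η + 1) ≤ 16 (η + 2)²`, whose two sides differ by `16
      -- η²`.
      · nlinarith [sq_nonneg (η : ℝ), (Nat.cast_nonneg η : (0 : ℝ) ≤ η)]
      · gcongr; linarith
    · have e1 : 4 * ((η + 2) * (((n : ℝ) + 1) ^ (η + 1))⁻¹ * M) =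
          (4 * (η + 2) * Real.pi) * M / (Real.pi * (n + 1) * ((n : ℝ) + 1) ^ η) := by
        field_simp; ring
      rw [e1]
      refine div_le_div₀ (by positivity) (mul_le_mul_of_nonneg_right ?_ hM) (by positivity) ?_
      · nlinarith [sq_nonneg (η : ℝ), (Nat.cast_nonneg η : (0 : ℝ) ≤ η)]
      · gcongr; linarith

/-! ### Piecewise smoothness gives a Lipschitz derivative -/

theorem iteratedDeriv_of_eqOn_Ioo {a b : ℝ} {K g : ℝ → ℝ}
    (hg : ContDiffOn ℝ ∞ g (Set.Icc a b)) (hKg : Set.EqOn K g (Set.Ioo a b)) (m : ℕ) {r : ℝ}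
    (hr : r ∈ Set.Ioo a b) :
    iteratedDeriv m K r = iteratedDerivWithin m g (Set.Icc a b) r ∧
      DifferentiableAt ℝ (iteratedDeriv m K) r := by
  have hab : a < b := hr.1.trans hr.2
  have hs := uniqueDiffOn_Icc hab
  have key : ∀ y ∈ Set.Ioo a b,
      iteratedDeriv m K y = iteratedDerivWithin m g (Set.Icc a b) y := by
    intro y hy
    have hgy : ContDiffAt ℝ m g y :=
      (hg.contDiffAt (Icc_mem_nhds hy.1 hy.2)).of_le (by exact_mod_cast le_top)
    rw [iteratedDerivWithin_eq_iteratedDeriv hs hgy (Set.Ioo_subset_Icc_self hy)]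
    exact (hKg.eventuallyEq_of_mem (Ioo_mem_nhds hy.1 hy.2)).iteratedDeriv_eq m
  refine ⟨key r hr, ?_⟩
  have hd : DifferentiableAt ℝ (iteratedDerivWithin m g (Set.Icc a b)) r :=
    (hg.differentiableOn_iteratedDerivWithin (by exact_mod_cast WithTop.coe_lt_top m) hs r
      (Set.Ioo_subset_Icc_self hr)).differentiableAt (Icc_mem_nhds hr.1 hr.2)
  exact hd.congr_of_eventuallyEq
    (Filter.eventuallyEq_of_mem (Ioo_mem_nhds hr.1 hr.2) key)

/-- Otherwise induction along the division would put every point, including the last one `π`,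
strictly to the left of `r`. -/
theorem IsDivision.exists_mem_Ioo {P : ℕ} {T : Fin (P + 1) → ℝ} (hT : IsDivision T) {r : ℝ}
    (hr : r ∈ Set.Icc (-Real.pi) Real.pi \ Set.range T) :
    ∃ i : Fin P, r ∈ Set.Ioo (T i.castSucc) (T i.succ) := by
  by_contra! h
  have hne : ∀ i, T i ≠ r := fun i hi => hr.2 ⟨i, hi⟩
  have hlt : ∀ i, T i < r := by
    intro i
    induction i using Fin.induction with
    | zero => exact lt_of_le_of_ne (hT.left ▸ hr.1.1) (hne _)
    | succ i ih =>
      refine lt_of_le_of_ne (not_lt.mp fun hlt => h i ⟨ih, hlt⟩) (hne _)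
  exact absurd hr.1.2 (not_le.mpr (hT.right ▸ hlt (Fin.last P)))

theorem IsPiecewiseSmooth.bddAbove_absDerivValues {P : ℕ} {T : Fin (P + 1) → ℝ} {K : ℝ → ℝ}
    (hT : IsDivision T) (hpw : IsPiecewiseSmooth T K) (m : ℕ) :
    BddAbove (absDerivValues T K m) := by
  have hC : ∀ i : Fin P, ∃ C : ℝ, ∀ r ∈ Set.Ioo (T i.castSucc) (T i.succ),
      |iteratedDeriv m K r| ≤ C := by
    intro i
    obtain ⟨g, hg, hKg⟩ := hpw i
    have hab : T i.castSucc < T i.succ := hT.strictMono i.castSucc_lt_succ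
    obtain ⟨C, hC⟩ := isCompact_Icc.exists_bound_of_continuousOn
      (hg.continuousOn_iteratedDerivWithin (m := m) (by exact_mod_cast le_top)
        (uniqueDiffOn_Icc hab))
    refine ⟨C, fun r hr => ?_⟩
    rw [(iteratedDeriv_of_eqOn_Ioo hg hKg m hr).1]
    exact hC r (Set.Ioo_subset_Icc_self hr)
  choose C hC using hC
  refine ⟨∑ i, |C i|, ?_⟩
  rintro _ ⟨r, hr, rfl⟩
  obtain ⟨i, hi⟩ := hT.exists_mem_Ioo hr
  exact (hC i r hi).trans ((le_abs_self _).trans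
    (Finset.single_le_sum (fun j _ => abs_nonneg (C j)) (Finset.mem_univ i)))

/-- A continuous function whose derivative is bounded by `M` off a countable set is
`M`-Lipschitz. -/
theorem abs_sub_le_of_abs_deriv_le_off_countable {h : ℝ → ℝ} (hc : Continuous h) {S : Set ℝ}
    (hS : S.Countable) {M : ℝ} (hd : ∀ x ∉ S, DifferentiableAt ℝ h x ∧ |deriv h x| ≤ M)
    (x y : ℝ) : |h x - h y| ≤ M * |x - y| := by
  have hae : ∀ᵐ t, t ∉ S := hS.ae_notMem MeasureTheory.volume
  have hint : IntervalIntegrable (deriv h) MeasureTheory.volume y x := by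
    refine (intervalIntegrable_const (c := M)).mono_fun'
      (measurable_deriv h).aestronglyMeasurable ?_
    filter_upwards [MeasureTheory.ae_restrict_of_ae hae] with t ht
    exact (hd t ht).2
  have hftc : ∫ t in y..x, deriv h t = h x - h y :=
    MeasureTheory.integral_eq_of_hasDerivAt_off_countable h (deriv h) hS hc.continuousOn
      (fun t ht => (hd t ht.2).1.hasDerivAt) hint
  rw [← hftc]
  refine intervalIntegral.norm_integral_le_of_norm_le_const_ae (f := deriv h) ?_
  filter_upwards [hae] with t ht _
  exact (hd t ht).2

theorem abs_iteratedDeriv_sub_le_maxAbsDeriv {η : ℕ} {K : ℝ → ℝ}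
    (hper : Function.Periodic K (2 * Real.pi)) (hcont : ContDiff ℝ η K) {P : ℕ}
    {T : Fin (P + 1) → ℝ} (hT : IsDivision T) (hpw : IsPiecewiseSmooth T K) (x y : ℝ) :
    |iteratedDeriv η K x - iteratedDeriv η K y| ≤ maxAbsDeriv T K (η + 1) * |x - y| := by
  have hbdd := hpw.bddAbove_absDerivValues hT (η + 1)
  have hperη := periodic_iteratedDeriv hper η
  refine abs_sub_le_of_abs_deriv_le_off_countable (hcont.continuous_iteratedDeriv' η)
    -- The exceptional set consists of all `2π`-translates of the division points; any other point
    -- is moved by periodicity into the interior of a piece.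
    (S := ⋃ k : ℤ, (fun t => t + k * (2 * Real.pi)) '' Set.range T)
    (Set.countable_iUnion fun k => (Set.countable_range T).image _) (fun z hz => ?_) x y
  obtain ⟨k, hk⟩ := exists_abs_sub_int_mul_two_pi_le z
  set r := z - k * (2 * Real.pi) with hr
  have hrmem : r ∈ Set.Icc (-Real.pi) Real.pi \ Set.range T := by
    refine ⟨abs_le.mp hk, fun hmem => hz ?_⟩
    exact Set.mem_iUnion.mpr ⟨k, r, hmem, by simp [hr]⟩
  obtain ⟨i, hi⟩ := hT.exists_mem_Ioo hrmem
  obtain ⟨g, hg, hKg⟩ := hpw i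
  have hshift : (fun t => iteratedDeriv η K (t - k * (2 * Real.pi))) = iteratedDeriv η K :=
    funext fun t => hperη.sub_int_mul_eq k
  constructor
  · rw [← hshift]
    exact differentiableAt_comp_sub_const.mpr (iteratedDeriv_of_eqOn_Ioo hg hKg η hi).2
  · rw [← iteratedDeriv_succ,
      ← (periodic_iteratedDeriv hper (η + 1)).sub_int_mul_eq k]
    exact le_csSup hbdd ⟨r, hrmem, rfl⟩

/-! ### The cosine form for even functions, and the conclusion -/

theorem integral_symm_of_even {f : ℝ → ℝ} (hf : Continuous f) (h : ∀ x, f (-x) = f x) (a : ℝ) :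
    ∫ t in -a..a, f t = 2 * ∫ t in (0 : ℝ)..a, f t := by
  rw [← intervalIntegral.integral_add_adjacent_intervals (hf.intervalIntegrable (-a) 0)
    (hf.intervalIntegrable 0 a)]
  have := intervalIntegral.integral_comp_neg f (a := 0) (b := a)
  simp_rw [h, neg_zero] at this
  rw [this]; ring

theorem integral_symm_of_odd {f : ℝ → ℝ} (h : ∀ x, f (-x) = -f x) (a : ℝ) :
    ∫ t in -a..a, f t = 0 := by
  have := intervalIntegral.integral_comp_neg f (a := -a) (b := a)
  simp_rw [h, neg_neg, intervalIntegral.integral_neg] at this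
  linarith

/-- The sine coefficients vanish and the cosine integrals are twice those over `[0, π]`; the weight
`1 / 2` at `j = 0` accounts for the constant term. -/
theorem vpSum_eq_vpFourierSum {K : ℝ → ℝ} (hK : Continuous K) (heven : ∀ x, K (-x) = K x)
    (n : ℕ) (r : ℝ) : vpSum n K r = vpFourierSum n K r := by
  have hpi := Real.pi_ne_zero
  have hS : ∀ ℓ, fourierPartialSum ℓ K r = (2 / Real.pi) * ∑ j ∈ Finset.range (ℓ + 1),
      vpWeight j * Real.cos (j * r) * ∫ τ in (0 : ℝ)..Real.pi, K τ * Real.cos (j * τ) := by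
    intro ℓ
    have hc : ∀ j : ℕ, ∫ τ in (-Real.pi)..Real.pi, K τ * Real.cos (j * τ) =
        2 * ∫ τ in (0 : ℝ)..Real.pi, K τ * Real.cos (j * τ) := fun j =>
      integral_symm_of_even (by fun_prop) (fun x => by rw [heven, mul_neg, Real.cos_neg]) _
    have hs : ∀ j : ℕ, ∫ τ in (-Real.pi)..Real.pi, K τ * Real.sin (j * τ) = 0 := fun j =>
      integral_symm_of_odd (fun x => by rw [heven, mul_neg, Real.sin_neg, mul_neg]) _
    unfold fourierPartialSum
    simp_rw [hc, hs, integral_symm_of_even hK heven]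
    rw [Finset.range_eq_Ico, Finset.sum_eq_sum_Ico_succ_bot (by omega), mul_add]
    have hI : Finset.Ico (0 + 1) (ℓ + 1) = Finset.Icc 1 ℓ := by
      ext; simp only [Finset.mem_Ico, Finset.mem_Icc]; omega
    rw [hI]
    congr 1
    · simp [vpWeight]; field_simp
    · rw [Finset.mul_sum, Finset.mul_sum]
      refine Finset.sum_congr rfl fun j hj => ?_
      have : j ≠ 0 := by rw [Finset.mem_Icc] at hj; omega
      simp only [vpWeight, this, if_false]
      ring
  unfold vpSum vpFourierSum
  simp_rw [hS]
  rw [← Finset.mul_sum, ← mul_assoc]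
  congr 1
  rw [div_mul_div_comm, one_mul]

/-- The finiteness of `M_{η+1}` and the error bound of the de la Vallée-Poussin sum, for a
`2π`-periodic piecewise smooth `K` of class `C^η`; for even `K` also in the cosine form. -/
theorem mainTheorem1 (η : ℕ) (K : ℝ → ℝ) (hper : Function.Periodic K (2 * Real.pi))
    (hcont : ContDiff ℝ η K) {P : ℕ} (T : Fin (P + 1) → ℝ) (hT : IsDivision T)
    (hpw : IsPiecewiseSmooth T K) :
    BddAbove (absDerivValues T K (η + 1)) ∧
      ∀ n : ℕ, 1 ≤ n → ∀ r : ℝ,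
        |vpFourierSum n K r - K r| ≤ vpErrorBound η n (maxAbsDeriv T K (η + 1)) ∧
        ((∀ x : ℝ, K (-x) = K x) →
          |vpSum n K r - K r| ≤ vpErrorBound η n (maxAbsDeriv T K (η + 1))) := by

  have hM : 0 ≤ maxAbsDeriv T K (η + 1) :=
    Real.sSup_nonneg (by rintro _ ⟨r, _, rfl⟩; exact abs_nonneg _)
  refine ⟨hpw.bddAbove_absDerivValues hT (η + 1), fun n hn r => ?_⟩
  have h := (abs_vpFourierSum_sub_self_le_approxConst hcont hper hM
    (abs_iteratedDeriv_sub_le_maxAbsDeriv hper hcont hT hpw) hn r).trans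
    (four_mul_approxConst_le hn hM)
  refine ⟨h, fun heven => ?_⟩
  rwa [vpSum_eq_vpFourierSum hcont.continuous heven]
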